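/- Let $E$ be a Polish space and let $C_b(E)$ be the set of bounded continuous functions $E\to\mathbb R$. Let $\mathbb D(E)$ be the space of càdlàg functions $\mathbb R_+\to E$ with the Skorokhod $J_1$ topology. Let $(\Omega,\mathcal F,\mathbf F,P)$ and $(\Omega^n,\mathcal F^n,\mathbf F^n,P^n)$, $n\in\mathbb N$, be filtered probability spaces supporting $E$-valued càdlàg adapted processes $X$ and $X^n$, respectively, where $\mathbf F$ is generated by $X$, i.e. $\mathcal F_t=\sigma(X_s,\ s\le t)$. Let $A\subset C_b(E)\times C_b(E)$. For every $n$ let $\mathfrak X^n$ be a set of pairs $(\xi,\phi)$ of real-valued progressively measurable processes on $(\Omega^n,\mathcal F^n,\mathbf F^n,P^n)$ such that $\sup_{s\le T}E^{P^n}[|\xi_s|+|\phi_s|]<\infty$ for all $T>0$ and $\xi-\int_0^\cdot\phi_s\,ds$ is a martingale. **Theorem.** Suppose that $X^n\to X$ weakly on $\mathbb D(E)$, and that there is a set $\Gamma\subset\mathbb R_+$ with countable complement such that for every $(f,g)\in A$ and every $T>0$ there is a sequence $(\xi^n,\phi^n)\in\mathfrak X^n$, $n\in\mathbb N$, with the following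 properties: 1. $\displaystyle\sup_{n\in\mathbb N}\sup_{s\le T}E^{P^n}\big[|\xi^n_s|+|\phi^n_s|\big]<\infty$; 2. $\displaystyle\lim_{n\to\infty}E^{P^n}\Big[(\xi^n_t-f(X^n_t))\prod_{i=1}^k h_i(X^n_{t_i})\Big]=0$ for all $t\in\Gamma\cap[0,T]$, $k\in\mathbb N$, $t_1,\dots,t_k\in\Gamma\cap[0,t]$ and $h_1,\dots,h_k\in C_b(E)$; 3. $\displaystyle\lim_{n\to\infty}E^{P^n}\Big[\int_s^t(\phi^n_u-g(X^n_u))\,du\,\prod_{i=1}^k h_i(X^n_{t_i})\Big]=0$ for all $s,t\in\Gamma\cap[0,T]$ with $s\le t$, $k\in\mathbb N$, $t_1,\dots,t_k\in\Gamma\cap[0,s]$ and $h_1,\dots,h_k\in C_b(E)$. Then $P$ solves the martingale problem for $A$: for every $(f,g)\in A$ the process $$f(X)-f(X_0)-\int_0^\cdot g(X_s)\,ds$$ is an $(\mathbf F,P)$-martingale. -/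

import Mathlib

open MeasureTheory ProbabilityTheory Filter Topology
open scoped NNReal ENNReal BoundedContinuousFunction

namespace MartingaleProblem

/-- The space `𝔻(E)` of càdlàg functions `ℝ₊ → E`: right-continuous with left limits.
(At time `0` the left limit condition is void, as `𝓝[<] 0 = ⊥` in `ℝ≥0`.) -/
@[ext]
structure CadlagPath (E : Type*) [TopologicalSpace E] where
  /-- the underlying function of time -/
  toFun : ℝ≥0 → E
  rightCts : ∀ t, ContinuousWithinAt toFun (Set.Ici t) t
  leftLim : ∀ t, ∃ l, Tendsto toFun (𝓝[<] t) (𝓝 l)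

instance {E : Type*} [TopologicalSpace E] : CoeFun (CadlagPath E) (fun _ => ℝ≥0 → E) :=
  ⟨CadlagPath.toFun⟩

/-- The set of paths `y` that are `ε`-close to `x` on `[0, T]` up to an `ε`-small change of time:
for some increasing bijection `lam` of `ℝ₊`, `|lam(t) - t| < ε` and `d(y(t), x(lam(t))) < ε`
for all `t ≤ T`. -/
def j1Ball {E : Type*} [MetricSpace E] (x : CadlagPath E) (T : ℝ≥0) (ε : ℝ) :
    Set (CadlagPath E) :=
  {y | ∃ lam : ℝ≥0 ≃o ℝ≥0, ∀ t ≤ T, dist (lam t) t < ε ∧ dist (y t) (x (lam t)) < ε}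

theorem j1Ball_mono {E : Type*} [MetricSpace E] (x : CadlagPath E) {T T' : ℝ≥0} {ε ε' : ℝ}
    (hT : T' ≤ T) (hε : ε ≤ ε') : j1Ball x T ε ⊆ j1Ball x T' ε' := by
  rintro y ⟨lam, h⟩
  exact ⟨lam, fun t ht =>
    ⟨(h t (ht.trans hT)).1.trans_le hε, (h t (ht.trans hT)).2.trans_le hε⟩⟩

/-- The Skorokhod `J₁` topology on `𝔻(E)`: a set is open if with each of its points `x` it contains
some `j1Ball x T ε`. This is the (metrizable) topology in which `x_n → x` iff for every `T` there
are increasing bijections `lam_n` of `ℝ₊` with `sup_{t ≤ T} |lam_n(t) - t| → 0` and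
`sup_{t ≤ T} d(x_n(t), x(lam_n(t))) → 0`. It depends on the metric of `E` only through the
topology of `E`. -/
instance {E : Type*} [MetricSpace E] : TopologicalSpace (CadlagPath E) where
  IsOpen U := ∀ x ∈ U, ∃ T : ℝ≥0, ∃ ε : ℝ, 0 < ε ∧ j1Ball x T ε ⊆ U
  isOpen_univ := fun _ _ => ⟨0, 1, one_pos, Set.subset_univ _⟩
  isOpen_inter := by
    rintro U V hU hV x ⟨hxU, hxV⟩
    obtain ⟨T, ε, hε, h⟩ := hU x hxU
    obtain ⟨T', ε', hε', h'⟩ := hV x hxV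
    exact ⟨max T T', min ε ε', lt_min hε hε', fun y hy =>
      ⟨h (j1Ball_mono x (le_max_left _ _) (min_le_left _ _) hy),
        h' (j1Ball_mono x (le_max_right _ _) (min_le_right _ _) hy)⟩⟩
  isOpen_sUnion := by
    rintro S hS x ⟨U, hU, hx⟩
    obtain ⟨T, ε, hε, h⟩ := hS U hU x hx
    exact ⟨T, ε, hε, h.trans (Set.subset_sUnion_of_mem hU)⟩

/-- `𝔻(E)` carries the Borel `σ`-field of the Skorokhod `J₁` topology. -/
instance {E : Type*} [MetricSpace E] : MeasurableSpace (CadlagPath E) := borel _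

instance {E : Type*} [MetricSpace E] : BorelSpace (CadlagPath E) := ⟨rfl⟩

/-- `P` solves the martingale problem given by the set `𝔛` of real-valued processes: all processes
in `𝔛` are `(F, P)`-martingales. -/
def IsSolution {Ω : Type*} {mΩ : MeasurableSpace Ω} (𝔛 : Set (ℝ≥0 → Ω → ℝ))
    (F : Filtration ℝ≥0 mΩ) (P : Measure Ω) : Prop :=
  ∀ Y ∈ 𝔛, Martingale Y F P

/-- The test processes `f(X) - f(X_0) - ∫_0^· g(X_s) ds`, `(f, g) ∈ A`. -/
def testProcesses {E Ω : Type*} [MetricSpace E] (A : Set ((E →ᵇ ℝ) × (E →ᵇ ℝ)))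
    (X : Ω → CadlagPath E) : Set (ℝ≥0 → Ω → ℝ) :=
  {Y | ∃ p ∈ A, Y = fun t ω =>
    p.1 (X ω t) - p.1 (X ω 0) - ∫ s in (0 : ℝ)..t, p.2 (X ω s.toNNReal)}

/-- The conditions on an approximating pair `(ξ, φ)` of real-valued processes: both are
progressively measurable, `sup_{s ≤ T} E[|ξ_s| + |φ_s|] < ∞` for every `T > 0`, and
`ξ - ∫_0^· φ_s ds` is a martingale. -/
structure IsMartingalePair {Ω : Type*} {mΩ : MeasurableSpace Ω} (F : Filtration ℝ≥0 mΩ)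
    (P : Measure Ω) (ξ φ : ℝ≥0 → Ω → ℝ) : Prop where
  prog_fst : IsProgressive F ξ
  prog_snd : IsProgressive F φ
  moment : ∀ T : ℝ≥0, 0 < T → (⨆ s ∈ Set.Iic T, ∫⁻ ω, (‖ξ s ω‖ₑ + ‖φ s ω‖ₑ) ∂P) < ∞
  martingale : Martingale (fun t ω => ξ t ω - ∫ s in (0 : ℝ)..t, φ s.toNNReal ω) F P

end MartingaleProblem

/-!
The martingale property of `f(X) - f(X_0) - ∫ g(X_s) ds` says that
`E[(f(X_t) - f(X_s) - ∫_s^t g(X_u) du) ∏ h_i(X_{t_i})] = 0` for all `t_i ≤ s ≤ t` and bounded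
continuous `h_i`, since products of this kind determine the `σ`-field of the past of `X`
(`martingale_natural_of_integral_sub_mul_prod_eq_zero`).

For `X^n` the same expectation is asymptotically zero as soon as all the times lie in `Γ`: by the
martingale property of `ξ - ∫ φ` it splits into the three approximation errors that the hypotheses
control (`IsMartingalePair.integral_pathIncrement_mul`).

Evaluation at a fixed time is not `J₁`-continuous, so the expectation at fixed times does not pass
to the weak limit directly. Instead, all the times are translated by the same `v` and the
functional is averaged over `v ∈ [0, ε]`. A càdlàg path has only countably many discontinuities, so
`J₁`-convergence implies convergence at almost every time, and the averaged functional is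
`J₁`-continuous (`continuous_integral_testFunctional`). As `Γ` has a countable complement, almost
every `v` moves all the times into `Γ`, and by Fubini and dominated convergence the averaged
expectation of the limit vanishes. Dividing by `ε` and letting `ε → 0`, right-continuity gives the
claim at the original times, which need neither be in `Γ` nor be times of almost sure
continuity of `X`.
-/

namespace MartingaleProblem

/-! ### Càdlàg paths and the `J₁` topology -/

namespace CadlagPath

variable {E : Type*} [MetricSpace E]

/-- The instants at which the oscillation of a càdlàg path is bounded below are isolated, so they
form a countable set. -/
theorem countable_not_continuousAt (x : CadlagPath E) : {t | ¬ContinuousAt x t}.Countable := by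
  let S : ℕ → Set ℝ≥0 := fun k =>
    {t | ¬∃ U ∈ 𝓝 t, ∀ u ∈ U, ∀ v ∈ U, dist (x u) (x v) < 1 / ((k : ℝ) + 1)}
  have hS : {t | ¬ContinuousAt x t} ⊆ ⋃ k, S k := by
    intro t ht
    by_contra hcon
    refine ht (Metric.tendsto_nhds.2 fun ε hε => ?_)
    obtain ⟨k, hk⟩ := exists_nat_one_div_lt hε
    have hk' : t ∉ S k := fun h => hcon (Set.mem_iUnion.2 ⟨k, h⟩)
    obtain ⟨U, hU, h⟩ := not_not.1 hk'
    filter_upwards [hU] with u hu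
    exact (h u hu t (mem_of_mem_nhds hU)).trans hk
  refine (Set.countable_iUnion fun k => ?_).mono hS
  have hε : (0 : ℝ) < 1 / ((k : ℝ) + 1) := Nat.one_div_pos_of_nat
  -- a one-sided limit at `t` makes the oscillation small on a one-sided punctured neighbourhood
  have side : ∀ (t : ℝ≥0) (l : E) (I : Set ℝ≥0), IsOpen I → Tendsto x (𝓝[I] t) (𝓝 l) →
      ∀ᶠ u in 𝓝[I] t, u ∉ S k := by
    intro t l I hI hl
    have hball := hl (Metric.ball_mem_nhds l (half_pos hε))
    obtain ⟨V, hV, htV, hVI⟩ := mem_nhdsWithin.1 hball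
    filter_upwards [inter_mem_nhdsWithin I (hV.mem_nhds htV)] with u hu
    refine not_not.2 ⟨V ∩ I, (hV.inter hI).mem_nhds ⟨hu.2, hu.1⟩, fun a ha b hb => ?_⟩
    have h1 : dist (x a) l < _ := hVI ha
    have h2 : dist (x b) l < _ := hVI hb
    linarith [dist_triangle_right (x a) (x b) l]
  have hiso : ∀ t, ∀ᶠ u in 𝓝[≠] t, u ∉ S k := by
    intro t
    rw [← Set.Iio_union_Ioi, nhdsWithin_union, eventually_sup]
    obtain ⟨l, hl⟩ := x.leftLim t
    exact ⟨side t l _ isOpen_Iio hl,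
      side t (x t) _ isOpen_Ioi ((x.rightCts t).mono Set.Ioi_subset_Ici_self)⟩
  have hdisc : DiscreteTopology (S k) := by
    rw [discreteTopology_subtype_iff]
    intro t _
    rw [← disjoint_iff, disjoint_principal_right]
    exact hiso t
  exact (HereditarilyLindelofSpace.isLindelof (S k)).countable hdisc

theorem continuousWithinAt_shift (x : CadlagPath E) (a v : ℝ≥0) :
    ContinuousWithinAt (fun w => x (a + w)) (Set.Ici v) v :=
  (x.rightCts (a + v)).comp (by fun_prop) fun _ hw => add_le_add_right hw a

/-- `J₁`-convergence implies convergence at the continuity points of the limit. -/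
theorem tendsto_apply {x : CadlagPath E} {y : ℕ → CadlagPath E} {T t : ℝ≥0} {ε : ℕ → ℝ}
    (hε : Tendsto ε atTop (𝓝 0)) (hy : ∀ n, y n ∈ j1Ball x T (ε n)) (ht : t ≤ T)
    (hc : ContinuousAt x t) : Tendsto (fun n => y n t) atTop (𝓝 (x t)) := by
  choose lam hlam using hy
  have h1 : Tendsto (fun n => lam n t) atTop (𝓝 t) :=
    tendsto_iff_dist_tendsto_zero.2 <| squeeze_zero (fun _ => dist_nonneg)
      (fun n => (hlam n t ht).1.le) hε
  have h2 : Tendsto (fun n => dist (x (lam n t)) (x t)) atTop (𝓝 0) :=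
    tendsto_iff_dist_tendsto_zero.1 (hc.tendsto.comp h1)
  refine tendsto_iff_dist_tendsto_zero.2 <| squeeze_zero (fun _ => dist_nonneg) (fun n => ?_)
    (by simpa using hε.add h2)
  exact (dist_triangle _ (x (lam n t)) _).trans (add_le_add (hlam n t ht).2.le le_rfl)

/-- A functional on `𝔻(E)` is continuous if it is sequentially continuous along the basic
`J₁`-balls over one fixed time horizon. -/
theorem continuous_of_tendsto {G : CadlagPath E → ℝ} (T : ℝ≥0)
    (h : ∀ x (y : ℕ → CadlagPath E), (∀ n : ℕ, y n ∈ j1Ball x T (1 / ((n : ℝ) + 1))) →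
      Tendsto (fun n => G (y n)) atTop (𝓝 (G x))) : Continuous G := by
  refine ⟨fun V hV x hx => ⟨T, ?_⟩⟩
  by_contra! hcon
  have hcon' : ∀ n : ℕ, ∃ y ∈ j1Ball x T (1 / ((n : ℝ) + 1)), y ∉ G ⁻¹' V := fun n =>
    Set.not_subset.1 (hcon _ Nat.one_div_pos_of_nat)
  choose y hy hyV using hcon'
  obtain ⟨n, hn⟩ := ((h x y hy).eventually (hV.mem_nhds hx)).exists
  exact hyV n hn

end CadlagPath

/-- Right-endpoint discretization of `ℝ₊` along the grid of mesh `1 / (n + 1)`. -/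
noncomputable def ceilGrid (n : ℕ) (t : ℝ≥0) : ℝ≥0 :=
  ⌈((n : ℝ≥0) + 1) * t⌉₊ / ((n : ℝ≥0) + 1)

theorem le_ceilGrid (n : ℕ) (t : ℝ≥0) : t ≤ ceilGrid n t := by
  rw [ceilGrid, le_div_iff₀ (by positivity), mul_comm]
  exact Nat.le_ceil _

theorem ceilGrid_le (n : ℕ) (t : ℝ≥0) : ceilGrid n t ≤ t + 1 / ((n : ℝ≥0) + 1) := by
  have hpos : (0 : ℝ≥0) < (n : ℝ≥0) + 1 := by positivity
  have h1 : (t + 1 / ((n : ℝ≥0) + 1)) * ((n : ℝ≥0) + 1) = ((n : ℝ≥0) + 1) * t + 1 := by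
    rw [add_mul t, one_div, inv_mul_cancel₀ hpos.ne', mul_comm t]
  rw [ceilGrid, div_le_iff₀ hpos, h1]
  exact (Nat.ceil_lt_add_one zero_le).le

theorem tendsto_ceilGrid (t : ℝ≥0) :
    Tendsto (fun n => ceilGrid n t) atTop (𝓝[Set.Ici t] t) := by
  refine tendsto_nhdsWithin_iff.2 ⟨?_, Eventually.of_forall fun n => le_ceilGrid n t⟩
  refine tendsto_of_tendsto_of_tendsto_of_le_of_le tendsto_const_nhds ?_
    (fun n => le_ceilGrid n t) (fun n => ceilGrid_le n t)
  have h0 : Tendsto (fun n : ℕ => 1 / ((n : ℝ≥0) + 1)) atTop (𝓝 0) :=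
    tendsto_one_div_add_atTop_nhds_zero_nat
  simpa using h0.const_add t

/-- A real-valued process with right-continuous paths is jointly measurable: it is the limit of
its right-endpoint discretizations. -/
theorem measurable_uncurry_of_rightCts {Ω : Type*} {m : MeasurableSpace Ω} {u : ℝ≥0 → Ω → ℝ}
    (hm : ∀ t, Measurable (u t))
    (hc : ∀ ω t, ContinuousWithinAt (fun s => u s ω) (Set.Ici t) t) :
    Measurable (Function.uncurry u) := by
  have hgrid : ∀ n, Measurable fun p : ℝ≥0 × Ω => u (ceilGrid n p.1) p.2 := fun n => by
    have h1 : Measurable fun q : ℕ × Ω => u (q.1 / ((n : ℝ≥0) + 1)) q.2 :=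
      measurable_from_prod_countable_right fun k => by exact hm (k / ((n : ℝ≥0) + 1))
    have h2 : Measurable fun t : ℝ≥0 => ((n : ℝ≥0) + 1) * t :=
      (continuous_const.mul continuous_id).measurable
    have h3 : Measurable fun p : ℝ≥0 × Ω => (⌈((n : ℝ≥0) + 1) * p.1⌉₊, p.2) :=
      (Nat.measurable_ceil.comp (h2.comp measurable_fst)).prodMk measurable_snd
    exact h1.comp h3
  have hlim := tendsto_ceilGrid
  generalize ceilGrid = d at hgrid hlim
  refine measurable_of_tendsto_metrizable (f := fun n p => u (d n p.1) p.2) hgrid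
    (tendsto_pi_nhds.2 fun p => ?_)
  have hp := (hc p.2 p.1).tendsto
  exact hp.comp (hlim p.1)

/-! ### Test functionals and their averages over translations of time -/

/-- Translates of a countable set of times are Lebesgue-null. -/
theorem ae_add_toNNReal_notMem {C : Set ℝ≥0} (hC : C.Countable) (a : ℝ≥0) :
    ∀ᵐ v : ℝ, 0 ≤ v → a + v.toNNReal ∉ C := by
  have h0 : {v : ℝ | 0 ≤ v ∧ a + v.toNNReal ∈ C}.Countable := by
    refine Set.MapsTo.countable_of_injOn (f := fun v : ℝ => a + v.toNNReal) (fun v hv => hv.2)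
      (fun v hv w hw hvw => ?_) hC
    have := add_left_cancel hvw
    rwa [Real.toNNReal_eq_toNNReal_iff hv.1 hw.1] at this
  filter_upwards [h0.ae_notMem volume] with v hv hv0 hmem
  exact hv ⟨hv0, hmem⟩

section Functional

variable {E : Type*} [MetricSpace E]

theorem CadlagPath.abs_integral_le (x : CadlagPath E) (g : E →ᵇ ℝ) (a b : ℝ) :
    |∫ u in a..b, g (x u.toNNReal)| ≤ ‖g‖ * |b - a| :=
  intervalIntegral.norm_integral_le_of_norm_le_const fun _ _ => g.norm_coe_le_norm _

/-- The increment over `[s, t]` of the test process of `(f, g)` along the path `x`. -/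
noncomputable def pathIncrement (f g : E →ᵇ ℝ) (s t : ℝ≥0) (x : CadlagPath E) : ℝ :=
  f (x t) - f (x s) - ∫ u in (s : ℝ)..t, g (x u.toNNReal)

/-- The increment over `[s, t]` of the test process of `(f, g)`, times the cylinder function
`∏ i, h i (x (τ i))`, with all times translated by `v`. -/
noncomputable def testFunctional (f g : E →ᵇ ℝ) (s t : ℝ≥0) {k : ℕ} (τ : Fin k → ℝ≥0)
    (h : Fin k → (E →ᵇ ℝ)) (v : ℝ≥0) (x : CadlagPath E) : ℝ :=
  pathIncrement f g (s + v) (t + v) x * ∏ i, h i (x (τ i + v))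

theorem abs_pathIncrement_le (f g : E →ᵇ ℝ) (s t : ℝ≥0) (x : CadlagPath E) :
    |pathIncrement f g s t x| ≤ ‖f‖ + ‖f‖ + ‖g‖ * |(t : ℝ) - s| := by
  have h1 := f.norm_coe_le_norm (x t)
  have h2 := f.norm_coe_le_norm (x s)
  have h3 := x.abs_integral_le g s t
  rw [Real.norm_eq_abs] at h1 h2
  exact (abs_sub _ _).trans (add_le_add ((abs_sub _ _).trans (add_le_add h1 h2)) h3)

theorem abs_prod_le {k : ℕ} (h : Fin k → (E →ᵇ ℝ)) (e : Fin k → E) :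
    |∏ i, h i (e i)| ≤ ∏ i, ‖h i‖ := by
  rw [Finset.abs_prod]
  exact Finset.prod_le_prod (fun _ _ => abs_nonneg _) fun i _ => (h i).norm_coe_le_norm _

theorem exists_bound_testFunctional (f g : E →ᵇ ℝ) (s t : ℝ≥0) {k : ℕ} (τ : Fin k → ℝ≥0)
    (h : Fin k → (E →ᵇ ℝ)) : ∃ C : ℝ, ∀ v x, ‖testFunctional f g s t τ h v x‖ ≤ C := by
  refine ⟨(‖f‖ + ‖f‖ + ‖g‖ * |(t : ℝ) - s|) * ∏ i, ‖h i‖, fun v x => ?_⟩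
  rw [Real.norm_eq_abs, testFunctional, abs_mul]
  have h1 := abs_pathIncrement_le f g (s + v) (t + v) x
  have h2 : ((t + v : ℝ≥0) : ℝ) - (s + v : ℝ≥0) = t - s := by push_cast; ring
  rw [h2] at h1
  exact mul_le_mul h1 (abs_prod_le h _) (abs_nonneg _) ((abs_nonneg _).trans h1)

variable [MeasurableSpace E] [BorelSpace E]

theorem CadlagPath.measurable (x : CadlagPath E) : Measurable x :=
  measurable_of_countable_not_continuousAt x.countable_not_continuousAt

theorem CadlagPath.intervalIntegrable (x : CadlagPath E) (g : E →ᵇ ℝ) (a b : ℝ) :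
    IntervalIntegrable (fun u : ℝ => g (x u.toNNReal)) volume a b := by
  have hm : Measurable fun u : ℝ => g (x u.toNNReal) :=
    g.continuous.measurable.comp (x.measurable.comp measurable_real_toNNReal)
  exact (intervalIntegrable_const (c := ‖g‖)).mono_fun hm.aestronglyMeasurable
    (ae_of_all _ fun u => by simpa using g.norm_coe_le_norm _)

theorem continuousWithinAt_testFunctional (f g : E →ᵇ ℝ) (s t : ℝ≥0) {k : ℕ} (τ : Fin k → ℝ≥0)
    (h : Fin k → (E →ᵇ ℝ)) (x : CadlagPath E) (v : ℝ≥0) :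
    ContinuousWithinAt (fun w => testFunctional f g s t τ h w x) (Set.Ici v) v := by
  have hf : ∀ (f : E →ᵇ ℝ) a, ContinuousWithinAt (fun w => f (x (a + w))) (Set.Ici v) v :=
    fun f a => f.continuous.continuousAt.comp_continuousWithinAt (x.continuousWithinAt_shift a v)
  have hprim : Continuous fun r : ℝ => ∫ u in (0 : ℝ)..r, g (x u.toNNReal) :=
    intervalIntegral.continuous_primitive (fun a b => x.intervalIntegrable g a b) 0
  have hint : Continuous fun w : ℝ≥0 =>
      ∫ u in ((s + w : ℝ≥0) : ℝ)..(t + w : ℝ≥0), g (x u.toNNReal) := by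
    have heq : ∀ w : ℝ≥0, ∫ u in ((s + w : ℝ≥0) : ℝ)..(t + w : ℝ≥0), g (x u.toNNReal) =
        (∫ u in (0 : ℝ)..(t + w : ℝ≥0), g (x u.toNNReal)) -
          ∫ u in (0 : ℝ)..(s + w : ℝ≥0), g (x u.toNNReal) := fun w =>
      (intervalIntegral.integral_interval_sub_left (x.intervalIntegrable g _ _)
        (x.intervalIntegrable g _ _)).symm
    simp_rw [heq]
    exact (hprim.comp (by fun_prop)).sub (hprim.comp (by fun_prop))
  exact (((hf f t).sub (hf f s)).sub hint.continuousWithinAt).mul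
    (tendsto_finsetProd _ fun i _ => hf (h i) (τ i))

/-- The test functional, averaged over a small translation of time, is `J₁`-continuous: at almost
every translation all the times involved are continuity points of the path. -/
theorem continuous_integral_testFunctional (f g : E →ᵇ ℝ) (s t : ℝ≥0) {k : ℕ}
    (τ : Fin k → ℝ≥0) (h : Fin k → (E →ᵇ ℝ)) (ε : ℝ≥0) :
    Continuous fun x : CadlagPath E =>
      ∫ v in (0 : ℝ)..ε, testFunctional f g s t τ h v.toNNReal x := by
  obtain ⟨C, hC⟩ := exists_bound_testFunctional f g s t τ h
  let T : ℝ≥0 := s + t + ∑ i, τ i + ε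
  refine CadlagPath.continuous_of_tendsto T fun x y hy => ?_
  have hlim : ∀ r ≤ T, ContinuousAt x r → Tendsto (fun n => y n r) atTop (𝓝 (x r)) :=
    fun r hr hx => CadlagPath.tendsto_apply tendsto_one_div_add_atTop_nhds_zero_nat hy hr hx
  have hmeas : ∀ z : CadlagPath E,
      Measurable fun v : ℝ => testFunctional f g s t τ h v.toNNReal z := fun z => by
    have h1 := measurable_uncurry_of_rightCts (Ω := Unit) (m := ⊤)
      (u := fun v _ => testFunctional f g s t τ h v z) (fun _ => measurable_const)
      (fun _ v => continuousWithinAt_testFunctional f g s t τ h z v)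
    exact h1.comp (measurable_real_toNNReal.prodMk (measurable_const (a := ())))
  have hcount := x.countable_not_continuousAt
  refine intervalIntegral.tendsto_integral_filter_of_dominated_convergence (fun _ => C)
    (Eventually.of_forall fun n => (hmeas _).aestronglyMeasurable)
    (Eventually.of_forall fun n => ae_of_all _ fun v _ => hC _ _) intervalIntegrable_const ?_
  filter_upwards [ae_add_toNNReal_notMem hcount s, ae_add_toNNReal_notMem hcount t,
    ae_all_iff.2 fun i => ae_add_toNNReal_notMem hcount (τ i)] with v hvs hvt hvτ hv
  rw [Set.uIoc_of_le (NNReal.coe_nonneg ε)] at hv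
  have hv0 : 0 ≤ v := hv.1.le
  have hvε : v.toNNReal ≤ ε := Real.toNNReal_le_iff_le_coe.2 hv.2
  have hsT : s + v.toNNReal ≤ T := add_le_add (by rw [add_assoc]; exact le_self_add) hvε
  have htT : t + v.toNNReal ≤ T :=
    add_le_add (le_add_of_le_left (le_add_of_nonneg_left s.2)) hvε
  have hτT : ∀ i, τ i + v.toNNReal ≤ T := fun i =>
    add_le_add (le_add_of_le_right
      (Finset.single_le_sum (f := τ) (fun _ _ => zero_le) (Finset.mem_univ i))) hvε
  have hpt : ∀ (f : E →ᵇ ℝ) (r : ℝ≥0), r ≤ T → r ∉ {t | ¬ContinuousAt x t} →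
      Tendsto (fun n => f (y n r)) atTop (𝓝 (f (x r))) := fun f r hr hx =>
    (f.continuous.tendsto _).comp (hlim r hr (not_not.1 hx))
  refine Tendsto.mul (Tendsto.sub (Tendsto.sub (hpt f _ htT (hvt hv0)) (hpt f _ hsT (hvs hv0)))
    ?_) (tendsto_finsetProd _ fun i _ => hpt (h i) _ (hτT i) (hvτ i hv0))
  refine intervalIntegral.tendsto_integral_filter_of_dominated_convergence (fun _ => ‖g‖)
    (Eventually.of_forall fun n => ?_)
    (Eventually.of_forall fun n => ae_of_all _ fun u _ => g.norm_coe_le_norm _)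
    intervalIntegrable_const ?_
  · exact (g.continuous.measurable.comp
      ((y n).measurable.comp measurable_real_toNNReal)).aestronglyMeasurable
  · filter_upwards [ae_add_toNNReal_notMem hcount 0] with u hu hmem
    have hu0 : 0 ≤ u := by
      rcases Set.mem_uIoc.1 hmem with hu' | hu'
      · exact (NNReal.coe_nonneg _).trans hu'.1.le
      · exact (NNReal.coe_nonneg _).trans hu'.1.le
    have huT : u.toNNReal ≤ T := by
      rcases Set.mem_uIoc.1 hmem with hu' | hu'
      · exact (Real.toNNReal_le_iff_le_coe.2 hu'.2).trans htT
      · exact (Real.toNNReal_le_iff_le_coe.2 hu'.2).trans hsT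
    have hu1 := hu hu0
    rw [zero_add] at hu1
    exact hpt g _ huT hu1

/-- The time integral of a bounded function of a càdlàg process is measurable with respect to the
information available at the end of the time interval. -/
theorem stronglyMeasurable_integral_path {Ω : Type*} {m : MeasurableSpace Ω}
    (X : Ω → CadlagPath E) (g : E →ᵇ ℝ) (s t : ℝ≥0) (hst : s ≤ t)
    (hX : ∀ u ≤ t, Measurable fun ω => X ω u) :
    StronglyMeasurable fun ω => ∫ u in (s : ℝ)..t, g (X ω u.toNNReal) := by
  -- stopping the process at time `t` does not change the integral
  have h1 : Measurable (Function.uncurry fun (u : ℝ≥0) (ω : Ω) => g (X ω (min u t))) := by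
    refine measurable_uncurry_of_rightCts
      (fun u => g.continuous.measurable.comp (hX _ (min_le_right _ _))) fun ω u => ?_
    refine g.continuous.continuousAt.comp_continuousWithinAt ?_
    exact ((X ω).rightCts (min u t)).comp (f := fun w => min w t) (by fun_prop)
      fun w hw => min_le_min_right t hw
  have h2 : Measurable fun p : Ω × ℝ => g (X p.1 (min p.2.toNNReal t)) :=
    h1.comp ((measurable_real_toNNReal.comp measurable_snd).prodMk measurable_fst)
  have h3 : StronglyMeasurable fun ω =>
      ∫ u in Set.Ioc (s : ℝ) t, g (X ω (min u.toNNReal t)) :=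
    h2.stronglyMeasurable.integral_prod_right' (ν := volume.restrict (Set.Ioc (s : ℝ) t))
  convert h3 using 2 with ω
  rw [intervalIntegral.integral_of_le (NNReal.coe_le_coe.2 hst)]
  refine setIntegral_congr_fun measurableSet_Ioc fun u hu => ?_
  have hut : u.toNNReal ≤ t := Real.toNNReal_le_iff_le_coe.2 hu.2
  simp only [min_eq_left hut]

theorem measurable_testFunctional {Ω : Type*} {m : MeasurableSpace Ω}
    (X : Ω → CadlagPath E) (hX : ∀ u, Measurable fun ω => X ω u) (f g : E →ᵇ ℝ) {s t : ℝ≥0}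
    (hst : s ≤ t) {k : ℕ} (τ : Fin k → ℝ≥0) (h : Fin k → (E →ᵇ ℝ)) (v : ℝ≥0) :
    Measurable fun ω => testFunctional f g s t τ h v (X ω) := by
  have hf : ∀ (f : E →ᵇ ℝ) u, Measurable fun ω => f (X ω u) := fun f u =>
    f.continuous.measurable.comp (hX u)
  exact (((hf f _).sub (hf f _)).sub (stronglyMeasurable_integral_path X g _ _
    (add_le_add_left hst v) fun u _ => hX u).measurable).mul
      (Finset.measurable_fun_prod _ fun i _ => hf (h i) _)

theorem integrable_uncurry_testFunctional {Ω : Type*} {m : MeasurableSpace Ω} (P : Measure Ω)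
    [IsProbabilityMeasure P] (X : Ω → CadlagPath E) (hX : ∀ u, Measurable fun ω => X ω u)
    (f g : E →ᵇ ℝ) {s t : ℝ≥0} (hst : s ≤ t) {k : ℕ} (τ : Fin k → ℝ≥0)
    (h : Fin k → (E →ᵇ ℝ)) (a b : ℝ) :
    Integrable (Function.uncurry fun (v : ℝ) ω => testFunctional f g s t τ h v.toNNReal (X ω))
      ((volume.restrict (Set.uIoc a b)).prod P) := by
  obtain ⟨C, hC⟩ := exists_bound_testFunctional f g s t τ h
  have h1 := measurable_uncurry_of_rightCts
    (fun v => measurable_testFunctional X hX f g hst τ h v)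
    (fun ω v => continuousWithinAt_testFunctional f g s t τ h (X ω) v)
  have h2 : Measurable
      (Function.uncurry fun (v : ℝ) ω => testFunctional f g s t τ h v.toNNReal (X ω)) :=
    h1.comp ((measurable_real_toNNReal.comp measurable_fst).prodMk measurable_snd)
  have : IsFiniteMeasure (volume.restrict (Set.uIoc a b)) := by
    rw [Set.uIoc]; infer_instance
  exact .of_bound h2.aestronglyMeasurable C (ae_of_all _ fun p => hC _ _)

end Functional

/-! ### The martingale pairs on the approximating spaces -/

section MartingalePair

variable {Ω : Type*} {mΩ : MeasurableSpace Ω} {F : Filtration ℝ≥0 mΩ} {P : Measure Ω}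

/-- Increments of a martingale are orthogonal to bounded functions of the past. -/
theorem integral_martingale_sub_mul_eq_zero [IsFiniteMeasure P] {M : ℝ≥0 → Ω → ℝ}
    (hM : Martingale M F P) {s t : ℝ≥0} (hst : s ≤ t) {H : Ω → ℝ}
    (hH : StronglyMeasurable[F s] H) {C : ℝ} (hC : ∀ ω, ‖H ω‖ ≤ C) :
    ∫ ω, (M t ω - M s ω) * H ω ∂P = 0 := by
  have hint : Integrable (M t - M s) P := (hM.integrable t).sub (hM.integrable s)
  have h1 : P[H * (M t - M s) | F s] =ᵐ[P] H * P[M t - M s | F s] :=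
    condExp_stronglyMeasurable_mul_of_bound (F.le s) hH hint C (ae_of_all _ hC)
  have h2 : P[M t - M s | F s] =ᵐ[P] P[M t | F s] - P[M s | F s] :=
    condExp_sub (hM.integrable t) (hM.integrable s) _
  have h3 : P[H * (M t - M s) | F s] =ᵐ[P] 0 := by
    filter_upwards [h1, h2, hM.2 s t hst, hM.2 s s le_rfl] with ω e1 e2 e3 e4
    rw [e1, Pi.mul_apply, e2, Pi.sub_apply, e3, e4, sub_self, mul_zero, Pi.zero_apply]
  calc ∫ ω, (M t ω - M s ω) * H ω ∂P = ∫ ω, (H * (M t - M s)) ω ∂P := by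
        simp only [Pi.mul_apply, Pi.sub_apply, mul_comm]
    _ = ∫ ω, (P[H * (M t - M s) | F s]) ω ∂P := (integral_condExp (F.le s)).symm
    _ = 0 := by rw [integral_congr_ae h3]; simp

namespace IsMartingalePair

variable {ξ φ : ℝ≥0 → Ω → ℝ}

theorem integrable_fst (h : IsMartingalePair F P ξ φ) (t : ℝ≥0) : Integrable (ξ t) P := by
  have hm0 : Measurable fun p : Set.Iic t × Ω => ξ p.1 p.2 :=
    (h.prog_fst t).mono (sup_le_sup le_rfl (MeasurableSpace.comap_mono (F.le t))) le_rfl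
  have hm : Measurable (ξ t) :=
    hm0.comp (measurable_prodMk_left (x := (⟨t, Set.mem_Iic.2 le_rfl⟩ : Set.Iic t)))
  refine ⟨hm.aestronglyMeasurable, ?_⟩
  calc ∫⁻ ω, ‖ξ t ω‖ₑ ∂P ≤ ∫⁻ ω, (‖ξ t ω‖ₑ + ‖φ t ω‖ₑ) ∂P :=
        lintegral_mono fun _ => le_self_add
    _ ≤ ⨆ s ∈ Set.Iic (t + 1), ∫⁻ ω, (‖ξ s ω‖ₑ + ‖φ s ω‖ₑ) ∂P :=
        le_iSup₂_of_le t (Set.mem_Iic.2 le_self_add) le_rfl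
    _ < ∞ := h.moment (t + 1) (by positivity)

/-- By Tonelli's theorem and the moment condition, almost all paths of `φ` are integrable on compact
time intervals. -/
theorem ae_intervalIntegrable_snd [IsProbabilityMeasure P] (h : IsMartingalePair F P ξ φ)
    (T : ℝ≥0) :
    ∀ᵐ ω ∂P, IntervalIntegrable (fun u : ℝ => φ u.toNNReal ω) volume 0 T := by
  have hm0 : Measurable fun p : Set.Iic T × Ω => φ p.1 p.2 :=
    (h.prog_snd T).mono (sup_le_sup le_rfl (MeasurableSpace.comap_mono (F.le T))) le_rfl
  have hq : Measurable fun q : ℝ × Ω =>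
      ((⟨min q.1.toNNReal T, Set.mem_Iic.2 (min_le_right _ _)⟩ : Set.Iic T), q.2) :=
    (((measurable_real_toNNReal.comp measurable_fst).min
      measurable_const).subtype_mk).prodMk measurable_snd
  have hm : Measurable fun q : ℝ × Ω => φ (min q.1.toNNReal T) q.2 := hm0.comp hq
  set K := ⨆ s ∈ Set.Iic (T + 1), ∫⁻ ω, (‖ξ s ω‖ₑ + ‖φ s ω‖ₑ) ∂P
  have hK : K < ∞ := h.moment (T + 1) (by positivity)
  have hfin : ∫⁻ ω, (∫⁻ u in Set.Ioc (0 : ℝ) T, ‖φ (min u.toNNReal T) ω‖ₑ) ∂P ≠ ∞ := by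
    rw [lintegral_lintegral_swap (f := fun ω (u : ℝ) => ‖φ (min u.toNNReal T) ω‖ₑ)
      (hm.comp measurable_swap).enorm.aemeasurable]
    refine ne_of_lt ((lintegral_mono (g := fun _ => K) fun u => ?_).trans_lt ?_)
    · exact (lintegral_mono fun _ => le_add_self).trans (le_iSup₂_of_le
        (f := fun s (_ : s ∈ Set.Iic (T + 1)) => ∫⁻ ω, (‖ξ s ω‖ₑ + ‖φ s ω‖ₑ) ∂P)
        (min u.toNNReal T) (Set.mem_Iic.2 ((min_le_right _ _).trans le_self_add)) le_rfl)
    · rw [lintegral_const]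
      exact ENNReal.mul_lt_top hK (by simp)
  have hmeas : Measurable fun ω =>
      ∫⁻ u in Set.Ioc (0 : ℝ) T, ‖φ (min u.toNNReal T) ω‖ₑ :=
    Measurable.lintegral_prod_right' (f := fun p : Ω × ℝ => ‖φ (min p.2.toNNReal T) p.1‖ₑ)
      (hm.comp measurable_swap).enorm
  filter_upwards [ae_lt_top hmeas hfin] with ω hω
  rw [intervalIntegrable_iff_integrableOn_Ioc_of_le (NNReal.coe_nonneg T)]
  have hint : IntegrableOn (fun u : ℝ => φ (min u.toNNReal T) ω) (Set.Ioc (0 : ℝ) T) :=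
    ⟨(hm.comp measurable_prodMk_right).aestronglyMeasurable, hω⟩
  refine hint.congr_fun (fun u hu => ?_) measurableSet_Ioc
  have huT : u.toNNReal ≤ T := Real.toNNReal_le_iff_le_coe.2 hu.2
  simp only [min_eq_left huT]

theorem integrable_integral_snd (h : IsMartingalePair F P ξ φ) (t : ℝ≥0) :
    Integrable (fun ω => ∫ u in (0 : ℝ)..t, φ u.toNNReal ω) P := by
  refine ((h.integrable_fst t).sub (h.martingale.integrable t)).congr (ae_of_all _ fun ω => ?_)
  simp only [Pi.sub_apply, sub_sub_cancel]

/-- The defect of the martingale property of the test process of `(f, g)` along `X`, tested against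
a bounded function `H` of the past, is made up of the errors of approximating `f(X)` by `ξ` at
the two end points and of the error of approximating `g(X)` by `φ` in between. -/
theorem integral_pathIncrement_mul {E : Type*} [MetricSpace E] [MeasurableSpace E] [BorelSpace E]
    [IsProbabilityMeasure P] (h : IsMartingalePair F P ξ φ) (X : Ω → CadlagPath E)
    (hX : ∀ u, Measurable fun ω => X ω u) (f g : E →ᵇ ℝ) {s t : ℝ≥0} (hst : s ≤ t) {H : Ω → ℝ}
    (hH : StronglyMeasurable[F s] H) {C : ℝ} (hC : ∀ ω, ‖H ω‖ ≤ C) :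
    ∫ ω, pathIncrement f g s t (X ω) * H ω ∂P =
      -(∫ ω, (ξ t ω - f (X ω t)) * H ω ∂P) + (∫ ω, (ξ s ω - f (X ω s)) * H ω ∂P) +
        ∫ ω, (∫ u in (s : ℝ)..t, (φ u.toNNReal ω - g (X ω u.toNNReal))) * H ω ∂P := by
  set M : ℝ≥0 → Ω → ℝ := fun t ω => ξ t ω - ∫ u in (0 : ℝ)..t, φ u.toNNReal ω with hMdef
  have hM : Martingale M F P := h.martingale
  have hmul : ∀ {Y : Ω → ℝ}, Integrable Y P → Integrable (fun ω => Y ω * H ω) P := fun hY =>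
    hY.mul_bdd (c := C) (hH.mono (F.le s)).aestronglyMeasurable (ae_of_all _ hC)
  have hf : ∀ u, Integrable (fun ω => f (X ω u)) P := fun u =>
    .of_bound (f.continuous.measurable.comp (hX u)).aestronglyMeasurable ‖f‖
      (ae_of_all _ fun ω => f.norm_coe_le_norm _)
  have hg : Integrable (fun ω => ∫ u in (s : ℝ)..t, g (X ω u.toNNReal)) P :=
    .of_bound (stronglyMeasurable_integral_path X g s t hst fun u _ => hX u).aestronglyMeasurable
      _ (ae_of_all _ fun ω => (X ω).abs_integral_le g s t)
  -- splitting the integral is legitimate only on the paths along which `φ` is integrable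
  have hsplit : (fun ω => ∫ u in (s : ℝ)..t, (φ u.toNNReal ω - g (X ω u.toNNReal))) =ᵐ[P]
      fun ω => (∫ u in (0 : ℝ)..t, φ u.toNNReal ω) - (∫ u in (0 : ℝ)..s, φ u.toNNReal ω) -
        ∫ u in (s : ℝ)..t, g (X ω u.toNNReal) := by
    filter_upwards [h.ae_intervalIntegrable_snd s, h.ae_intervalIntegrable_snd t] with ω hs ht
    rw [intervalIntegral.integral_sub (hs.symm.trans ht) ((X ω).intervalIntegrable g _ _),
      intervalIntegral.integral_interval_sub_left ht hs]
  have hD : Integrable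
      (fun ω => ∫ u in (s : ℝ)..t, (φ u.toNNReal ω - g (X ω u.toNNReal))) P :=
    (((h.integrable_integral_snd t).sub (h.integrable_integral_snd s)).sub hg).congr hsplit.symm
  have h1 := (hmul ((h.integrable_fst t).sub (hf t))).fun_neg
  have h2 := hmul ((h.integrable_fst s).sub (hf s))
  have h3 := hmul hD
  have h4 := hmul ((hM.integrable t).sub (hM.integrable s))
  simp only [Pi.sub_apply] at h1 h2 h4
  have h5 : ∫ ω, (M t ω - M s ω) * H ω ∂P = 0 :=
    integral_martingale_sub_mul_eq_zero hM hst hH hC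
  have h6 : ∫ ω, pathIncrement f g s t (X ω) * H ω ∂P =
      ∫ ω, (-((ξ t ω - f (X ω t)) * H ω) + (ξ s ω - f (X ω s)) * H ω +
        (∫ u in (s : ℝ)..t, (φ u.toNNReal ω - g (X ω u.toNNReal))) * H ω +
        (M t ω - M s ω) * H ω) ∂P := by
    refine integral_congr_ae ?_
    filter_upwards [hsplit] with ω hω
    simp only [hω, pathIncrement, hMdef]
    ring
  rw [h6, integral_add ((h1.fun_add h2).fun_add h3) h4, integral_add (h1.fun_add h2) h3,
    integral_add h1 h2, integral_neg, h5, add_zero]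

end IsMartingalePair

end MartingalePair

/-! ### Martingales for the filtration generated by a process -/

section NaturalFiltration

variable {Ω E ι : Type*} {mΩ : MeasurableSpace Ω} {P : Measure Ω}

/-- The indicator of a closed set is a bounded pointwise limit of bounded continuous functions. -/
theorem exists_seq_tendsto_indicator_of_isClosed [TopologicalSpace E] [HasOuterApproxClosed E]
    {C : Set E} (hC : IsClosed C) :
    ∃ a : ℕ → (E →ᵇ ℝ), (∀ n x, |a n x| ≤ 1) ∧
      ∀ x, Tendsto (fun n => a n x) atTop (𝓝 (C.indicator 1 x)) := by
  have hle : ∀ n x, ‖(hC.apprSeq n x : ℝ)‖ ≤ 1 := fun n x => by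
    rw [Real.norm_of_nonneg (NNReal.coe_nonneg _)]
    exact_mod_cast HasOuterApproxClosed.apprSeq_apply_le_one hC n x
  refine ⟨fun n => .ofNormedAddCommGroup (fun x => (hC.apprSeq n x : ℝ)) (by fun_prop) 1 (hle n),
    hle, fun x => ?_⟩
  have h := tendsto_pi_nhds.1 (HasOuterApproxClosed.tendsto_apprSeq hC) x
  have h' := NNReal.tendsto_coe.2 h
  have heq : ((C.indicator (fun _ => (1 : ℝ≥0)) x : ℝ≥0) : ℝ) = C.indicator 1 x := by
    by_cases hx : x ∈ C <;> simp [hx]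
  rwa [heq] at h'

variable [TopologicalSpace E] [HasOuterApproxClosed E] [MeasurableSpace E] [BorelSpace E]

/-- A random variable that is orthogonal to all products of bounded continuous functions of
finitely many of the variables `X j`, `j ∈ S`, has integral zero over all events that are generated
by these variables. -/
theorem setIntegral_eq_zero_of_integral_mul_prod_eq_zero {X : ι → Ω → E}
    (hX : ∀ j, Measurable (X j)) (S : Set ι) {Y : Ω → ℝ} (hY : Integrable Y P)
    (hYX : ∀ (k : ℕ) (τ : Fin k → ι) (h : Fin k → (E →ᵇ ℝ)), (∀ i, τ i ∈ S) →
      ∫ ω, Y ω * ∏ i, h i (X (τ i) ω) ∂P = 0)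
    {B : Set Ω} (hB : MeasurableSet[⨆ j ∈ S, MeasurableSpace.comap (X j) inferInstance] B) :
    ∫ ω in B, Y ω ∂P = 0 := by
  let π : ι → Set (Set Ω) := fun j => {A | ∃ C, IsClosed C ∧ X j ⁻¹' C = A}
  have hπ : ∀ j, MeasurableSpace.generateFrom (π j) =
      MeasurableSpace.comap (X j) inferInstance := fun j => by
    rw [BorelSpace.measurable_eq (α := E), borel_eq_generateFrom_isClosed,
      MeasurableSpace.comap_generateFrom]
    rfl
  have hpi : ∀ j, IsPiSystem (π j) := by
    rintro j _ ⟨C, hC, rfl⟩ _ ⟨D, hD, rfl⟩ _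
    exact ⟨C ∩ D, hC.inter hD, Set.preimage_inter⟩
  have hle : (⨆ j ∈ S, MeasurableSpace.comap (X j) inferInstance) ≤ mΩ :=
    iSup₂_le fun j _ => (hX j).comap_le
  have hgen : (⨆ j ∈ S, MeasurableSpace.comap (X j) inferInstance) =
      MeasurableSpace.generateFrom (piiUnionInter π S) := by
    refine le_antisymm (iSup₂_le fun j hj => ?_) (MeasurableSpace.generateFrom_le ?_)
    · rw [← hπ j]
      exact le_generateFrom_piiUnionInter S hj
    · rintro _ ⟨I, hI, A, hA, rfl⟩
      refine Finset.measurableSet_biInter _ fun j hj => ?_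
      refine le_iSup₂ (f := fun j (_ : j ∈ S) => MeasurableSpace.comap (X j) inferInstance)
        j (hI hj) _ ?_
      rw [← hπ j]
      exact MeasurableSpace.measurableSet_generateFrom (hA j hj)
  have htotal : ∫ ω, Y ω ∂P = 0 := by
    simpa using hYX 0 Fin.elim0 Fin.elim0 (fun i => i.elim0)
  induction B, hB using MeasurableSpace.induction_on_inter hgen (isPiSystem_piiUnionInter π hpi S)
    with
  | empty => simp
  | basic B hB =>
    obtain ⟨I, hI, A, hA, rfl⟩ := hB
    let τ : Fin I.card → ι := fun i => (I.equivFin.symm i : ι)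
    have hτ : ∀ i, τ i ∈ I := fun i => (I.equivFin.symm i).2
    choose C hC hCA using fun i => hA (τ i) (hτ i)
    choose a ha halim using fun i => exists_seq_tendsto_indicator_of_isClosed (hC i)
    have hprod : ∀ ω, ∏ i, (C i).indicator (1 : E → ℝ) (X (τ i) ω) =
        (⋂ j ∈ I, A j).indicator 1 ω := fun ω => by
      have hmem : ∀ i, X (τ i) ω ∈ C i ↔ ω ∈ A (τ i) := fun i => by
        rw [← hCA i, Set.mem_preimage]
      by_cases hω : ω ∈ ⋂ j ∈ I, A j
      · rw [Set.indicator_of_mem hω]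
        refine Finset.prod_eq_one fun i _ => ?_
        rw [Set.indicator_of_mem ((hmem i).2 (Set.mem_iInter₂.1 hω _ (hτ i)))]
        rfl
      · rw [Set.indicator_of_notMem hω]
        simp only [Set.mem_iInter, not_forall] at hω
        obtain ⟨j, hj, hωj⟩ := hω
        have hτj : τ (I.equivFin ⟨j, hj⟩) = j := by simp [τ]
        refine Finset.prod_eq_zero (Finset.mem_univ (I.equivFin ⟨j, hj⟩)) ?_
        refine Set.indicator_of_notMem (fun hmem' => hωj ?_) _
        have := (hmem _).1 hmem'
        rwa [hτj] at this
    have hBm : MeasurableSet (⋂ j ∈ I, A j) :=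
      Finset.measurableSet_biInter _ fun j hj => by
        obtain ⟨C, hC, hCj⟩ := hA j hj
        exact hCj ▸ hX j hC.measurableSet
    have hlim : Tendsto (fun n => ∫ ω, Y ω * ∏ i, a i n (X (τ i) ω) ∂P) atTop
        (𝓝 (∫ ω, Y ω * (⋂ j ∈ I, A j).indicator 1 ω ∂P)) := by
      refine tendsto_integral_of_dominated_convergence (fun ω => |Y ω|) (fun n => ?_) hY.abs
        (fun n => ae_of_all _ fun ω => ?_) (ae_of_all _ fun ω => ?_)
      · exact hY.aestronglyMeasurable.mul (Finset.measurable_fun_prod _ fun i _ =>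
          (a i n).continuous.measurable.comp (hX _)).aestronglyMeasurable
      · rw [Real.norm_eq_abs, abs_mul, Finset.abs_prod]
        exact mul_le_of_le_one_right (abs_nonneg _)
          (Finset.prod_le_one (fun _ _ => abs_nonneg _) fun i _ => ha i n _)
      · rw [← hprod ω]
        exact (tendsto_finsetProd _ fun i _ => halim i _).const_mul _
    have hzero : ∫ ω, Y ω * (⋂ j ∈ I, A j).indicator 1 ω ∂P = 0 := by
      refine tendsto_nhds_unique hlim ?_
      simp only [hYX _ τ (fun i => a i _) fun i => hI (hτ i)]
      exact tendsto_const_nhds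
    rw [← integral_indicator hBm, ← hzero]
    refine integral_congr_ae (ae_of_all _ fun ω => ?_)
    by_cases hω : ω ∈ ⋂ j ∈ I, A j
    · simp only [Set.indicator_of_mem hω, Pi.one_apply, mul_one]
    · simp only [Set.indicator_of_notMem hω, mul_zero]
  | compl B hB ih =>
    have h := integral_add_compl (hle _ hB) hY
    rwa [ih, htotal, zero_add] at h
  | iUnion A hd hA ih =>
    rw [integral_iUnion (fun i => hle _ (hA i)) hd hY.integrableOn]
    simp [ih]

/-- An adapted integrable process whose increments are orthogonal to the products of bounded
continuous functions of past values of `X` is a martingale for the filtration generated by `X`. -/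
theorem martingale_natural_of_integral_sub_mul_prod_eq_zero [Preorder ι]
    [TopologicalSpace.MetrizableSpace E] [IsFiniteMeasure P]
    {X : ι → Ω → E} (hX : ∀ j, StronglyMeasurable (X j)) {Y : ι → Ω → ℝ}
    (hYm : StronglyAdapted (Filtration.natural X hX) Y) (hY : ∀ t, Integrable (Y t) P)
    (hYX : ∀ s t, s ≤ t → ∀ (k : ℕ) (τ : Fin k → ι) (h : Fin k → (E →ᵇ ℝ)), (∀ i, τ i ≤ s) →
      ∫ ω, (Y t ω - Y s ω) * ∏ i, h i (X (τ i) ω) ∂P = 0) :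
    Martingale Y (Filtration.natural X hX) P := by
  refine ⟨hYm, fun s t hst => (ae_eq_condExp_of_forall_setIntegral_eq
    ((Filtration.natural X hX).le s) (hY t) (fun _ _ _ => (hY s).integrableOn)
    (fun B hB _ => ?_) (hYm s).aestronglyMeasurable).symm⟩
  have h0 := setIntegral_eq_zero_of_integral_mul_prod_eq_zero (fun j => (hX j).measurable)
    {j | j ≤ s} ((hY t).sub (hY s)) (hYX s t hst) hB
  have h1 : ∫ ω in B, (Y t ω - Y s ω) ∂P = 0 := h0
  rw [integral_sub (hY t).integrableOn (hY s).integrableOn] at h1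
  linarith

end NaturalFiltration

/-! ### Passing to the weak limit -/

section WeakLimit

variable {E : Type*} [MetricSpace E]
  {Ω : Type*} {mΩ : MeasurableSpace Ω} {P : Measure Ω} [IsProbabilityMeasure P]
  {X : Ω → CadlagPath E}
  {Ω' : ℕ → Type*} {mΩ' : ∀ n, MeasurableSpace (Ω' n)} {P' : ∀ n, Measure (Ω' n)}
  [∀ n, IsProbabilityMeasure (P' n)] {X' : ∀ n, Ω' n → CadlagPath E}

/-- Convergence in distribution on `𝔻(E)`, tested on bounded continuous functionals. -/
theorem tendsto_integral_of_tendstoInDistribution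
    (hconv : TendstoInDistribution X' atTop X P' P) {G : CadlagPath E → ℝ} (hG : Continuous G)
    {C : ℝ} (hC : ∀ x, ‖G x‖ ≤ C) :
    Tendsto (fun n => ∫ ω, G (X' n ω) ∂(P' n)) atTop (𝓝 (∫ ω, G (X ω) ∂P)) := by
  have h := ProbabilityMeasure.tendsto_iff_forall_integral_tendsto.1 hconv.tendsto
    (.ofNormedAddCommGroup G hG C hC)
  have hG' : ∀ μ : Measure (CadlagPath E), AEStronglyMeasurable G μ := fun μ =>
    hG.measurable.aestronglyMeasurable
  simp only [ProbabilityMeasure.coe_mk, BoundedContinuousFunction.coe_ofNormedAddCommGroup] at h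
  simpa only [integral_map hconv.aemeasurable_limit (hG' _),
    integral_map (hconv.forall_aemeasurable _) (hG' _)] using h

variable [MeasurableSpace E] [BorelSpace E]

theorem integral_integral_testFunctional_swap (hX : ∀ u, Measurable fun ω => X ω u)
    (f g : E →ᵇ ℝ) {s t : ℝ≥0} (hst : s ≤ t) {k : ℕ} (τ : Fin k → ℝ≥0) (h : Fin k → (E →ᵇ ℝ))
    (a b : ℝ) :
    ∫ v in a..b, ∫ ω, testFunctional f g s t τ h v.toNNReal (X ω) ∂P =
      ∫ ω, (∫ v in a..b, testFunctional f g s t τ h v.toNNReal (X ω)) ∂P :=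
  intervalIntegral_integral_swap
    (integrable_uncurry_testFunctional P X hX f g hst τ h a b)

/-- If the averages over all small translations of time of the expected test functional vanish,
then so does the expected test functional without translation, by right-continuity of paths. -/
theorem integral_testFunctional_zero_eq_zero (hX : ∀ u, Measurable fun ω => X ω u)
    (f g : E →ᵇ ℝ) {s t : ℝ≥0} (hst : s ≤ t) {k : ℕ} (τ : Fin k → ℝ≥0) (h : Fin k → (E →ᵇ ℝ))
    (hzero : ∀ ε : ℝ≥0, ε ≤ 1 →
      ∫ ω, (∫ v in (0 : ℝ)..ε, testFunctional f g s t τ h v.toNNReal (X ω)) ∂P = 0) :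
    ∫ ω, testFunctional f g s t τ h 0 (X ω) ∂P = 0 := by
  obtain ⟨C, hC⟩ := exists_bound_testFunctional f g s t τ h
  let e : ℝ → ℝ := fun v => ∫ ω, testFunctional f g s t τ h v.toNNReal (X ω) ∂P
  have hcont : ContinuousWithinAt e (Set.Ioi 0) 0 := by
    refine tendsto_integral_filter_of_dominated_convergence (fun _ => C)
      (Eventually.of_forall fun v =>
        (measurable_testFunctional X hX f g hst τ h _).aestronglyMeasurable)
      (Eventually.of_forall fun v => ae_of_all _ fun ω => hC _ _) (integrable_const C)
      (ae_of_all _ fun ω => ?_)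
    have h1 := continuousWithinAt_testFunctional f g s t τ h (X ω) (Real.toNNReal 0)
    have h2 : Tendsto Real.toNNReal (𝓝[>] 0) (𝓝[≥] (Real.toNNReal 0)) :=
      tendsto_nhdsWithin_iff.2 ⟨(continuous_real_toNNReal.tendsto 0).mono_left nhdsWithin_le_nhds,
        eventually_nhdsWithin_of_forall fun v hv => Real.toNNReal_le_toNNReal (le_of_lt hv)⟩
    exact h1.tendsto.comp h2
  have hmeas : StronglyMeasurableAtFilter e (𝓝[>] 0) := by
    refine ⟨Set.Ioc 0 1, Ioc_mem_nhdsGT one_pos, ?_⟩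
    have := (integrable_uncurry_testFunctional P X hX f g hst τ h 0 1).integral_prod_left
    rw [Set.uIoc_of_le zero_le_one] at this
    exact this.aestronglyMeasurable
  have hderiv : HasDerivWithinAt (fun u => ∫ v in (0 : ℝ)..u, e v) (e 0) (Set.Ici 0) 0 :=
    intervalIntegral.integral_hasDerivWithinAt_right IntervalIntegrable.refl hmeas hcont
  have hderiv0 : HasDerivWithinAt (fun u => ∫ v in (0 : ℝ)..u, e v) 0 (Set.Ici 0) 0 := by
    refine (hasDerivWithinAt_const (0 : ℝ) (Set.Ici 0) (0 : ℝ)).congr_of_eventuallyEq ?_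
      intervalIntegral.integral_same
    filter_upwards [Icc_mem_nhdsGE (one_pos (α := ℝ))] with u hu
    have := hzero ⟨u, hu.1⟩ hu.2
    rwa [← integral_integral_testFunctional_swap hX f g hst τ h] at this
  have := (uniqueDiffOn_Ici (0 : ℝ) 0 Set.self_mem_Ici).eq_deriv _ hderiv hderiv0
  simpa [e] using this

/-- If the expected test functionals of the approximating processes tend to zero at almost every
translation of time, then the expected test functional of the weak limit vanishes, at every choice
of times. -/
theorem integral_testFunctional_zero_eq_zero_of_tendsto
    (hconv : TendstoInDistribution X' atTop X P' P) (hX : ∀ u, Measurable fun ω => X ω u)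
    (hX' : ∀ n u, Measurable fun ω => X' n ω u)
    (f g : E →ᵇ ℝ) {s t : ℝ≥0} (hst : s ≤ t) {k : ℕ} (τ : Fin k → ℝ≥0) (h : Fin k → (E →ᵇ ℝ))
    (hlim : ∀ᵐ v : ℝ, 0 ≤ v → v ≤ 1 → Tendsto
      (fun n => ∫ ω, testFunctional f g s t τ h v.toNNReal (X' n ω) ∂(P' n)) atTop (𝓝 0)) :
    ∫ ω, testFunctional f g s t τ h 0 (X ω) ∂P = 0 := by
  refine integral_testFunctional_zero_eq_zero hX f g hst τ h fun ε hε => ?_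
  obtain ⟨C, hC⟩ := exists_bound_testFunctional f g s t τ h
  have h1 := tendsto_integral_of_tendstoInDistribution hconv
    (continuous_integral_testFunctional f g s t τ h ε)
    (fun x => intervalIntegral.norm_integral_le_of_norm_le_const fun v _ => hC _ x)
  refine tendsto_nhds_unique h1 ?_
  simp only [← integral_integral_testFunctional_swap (hX' _) f g hst τ h]
  have h2 : Tendsto (fun n => ∫ v in (0 : ℝ)..ε, ∫ ω,
      testFunctional f g s t τ h v.toNNReal (X' n ω) ∂(P' n)) atTop
      (𝓝 (∫ _ in (0 : ℝ)..ε, (0 : ℝ))) := by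
    refine intervalIntegral.tendsto_integral_filter_of_dominated_convergence (fun _ => C)
      (Eventually.of_forall fun n => ?_) (Eventually.of_forall fun n => ae_of_all _ fun v _ => ?_)
      intervalIntegrable_const ?_
    · exact (integrable_uncurry_testFunctional (P' n) (X' n) (hX' n) f g hst τ h
        0 ε).integral_prod_left.aestronglyMeasurable
    · exact (norm_integral_le_of_norm_le_const (ae_of_all _ fun ω => hC _ _)).trans (by simp)
    · filter_upwards [hlim] with v hv hmem
      rw [Set.uIoc_of_le (NNReal.coe_nonneg ε)] at hmem
      exact hv hmem.1.le (hmem.2.trans (by exact_mod_cast hε))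
  simpa using h2

end WeakLimit

end MartingaleProblem

theorem theorem3p1
    {E : Type*} [MetricSpace E] [PolishSpace E] [MeasurableSpace E] [BorelSpace E]
    -- the limit space, with a càdlàg process `X`
    {Ω : Type*} {mΩ : MeasurableSpace Ω} (P : Measure Ω) [IsProbabilityMeasure P]
    (X : Ω → MartingaleProblem.CadlagPath E) (hX : ∀ t, StronglyMeasurable (fun ω => X ω t))
    -- the approximating filtered spaces, with adapted càdlàg processes `X' n`
    {Ω' : ℕ → Type*} {mΩ' : ∀ n, MeasurableSpace (Ω' n)} (F' : ∀ n, Filtration ℝ≥0 (mΩ' n))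
    (P' : ∀ n, Measure (Ω' n)) [∀ n, IsProbabilityMeasure (P' n)]
    (X' : ∀ n, Ω' n → MartingaleProblem.CadlagPath E)
    (hX' : ∀ n, StronglyAdapted (F' n) (fun t ω => X' n ω t))
    (A : Set ((E →ᵇ ℝ) × (E →ᵇ ℝ)))
    -- the sets of pairs of processes on the approximating spaces
    (𝔛' : ∀ n, Set ((ℝ≥0 → Ω' n → ℝ) × (ℝ≥0 → Ω' n → ℝ)))
    (h𝔛' : ∀ n, ∀ p ∈ 𝔛' n, MartingaleProblem.IsMartingalePair (F' n) (P' n) p.1 p.2)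
    -- weak convergence on the Skorokhod space
    (hconv : TendstoInDistribution X' atTop X P' P)
    (Γ : Set ℝ≥0) (hΓ : Γᶜ.Countable)
    (happrox : ∀ p ∈ A, ∀ T : ℝ≥0, 0 < T →
      ∃ ξ φ : ∀ n, ℝ≥0 → Ω' n → ℝ, (∀ n, (ξ n, φ n) ∈ 𝔛' n) ∧
        ((⨆ n, ⨆ s ∈ Set.Iic T, ∫⁻ ω, (‖ξ n s ω‖ₑ + ‖φ n s ω‖ₑ) ∂(P' n)) < ∞) ∧
        (∀ t ∈ Γ ∩ Set.Iic T, ∀ (k : ℕ) (τ : Fin k → ℝ≥0) (h : Fin k → (E →ᵇ ℝ)),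
          (∀ i, τ i ∈ Γ ∩ Set.Iic t) →
          Tendsto (fun n => ∫ ω, (ξ n t ω - p.1 (X' n ω t)) * ∏ i, h i (X' n ω (τ i)) ∂(P' n))
            atTop (𝓝 0)) ∧
        (∀ t ∈ Γ ∩ Set.Iic T, ∀ s ∈ Γ ∩ Set.Iic t,
          ∀ (k : ℕ) (τ : Fin k → ℝ≥0) (h : Fin k → (E →ᵇ ℝ)),
          (∀ i, τ i ∈ Γ ∩ Set.Iic s) →
          Tendsto (fun n => ∫ ω, (∫ u in (s : ℝ)..t, (φ n u.toNNReal ω - p.2 (X' n ω u.toNNReal))) *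
            ∏ i, h i (X' n ω (τ i)) ∂(P' n)) atTop (𝓝 0))) :
    MartingaleProblem.IsSolution (MartingaleProblem.testProcesses A X)
      (Filtration.natural (fun t ω => X ω t) hX) P := by
  intro Y hY
  obtain ⟨p, hp, rfl⟩ := hY
  have hXm : ∀ u, Measurable fun ω => X ω u := fun u => (hX u).measurable
  have hX'm : ∀ n u, Measurable fun ω => X' n ω u := fun n u =>
    ((hX' n u).mono ((F' n).le u)).measurable
  have hXF : ∀ {u t : ℝ≥0}, u ≤ t →
      Measurable[Filtration.natural (fun t ω => X ω t) hX t] fun ω => X ω u := fun {u t} hut =>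
    ((Filtration.stronglyAdapted_natural hX u).mono
      ((Filtration.natural (fun t ω => X ω t) hX).mono hut)).measurable
  have hadapted : StronglyAdapted (Filtration.natural (fun t ω => X ω t) hX)
      (fun t ω => p.1 (X ω t) - p.1 (X ω 0) - ∫ s in (0 : ℝ)..t, p.2 (X ω s.toNNReal)) :=
    fun t => by
      have hint := MartingaleProblem.stronglyMeasurable_integral_path X p.2 0 t zero_le
        fun u hu => hXF hu
      exact ((p.1.continuous.measurable.comp (hXF le_rfl)).sub
        (p.1.continuous.measurable.comp (hXF zero_le))).stronglyMeasurable.sub hint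
  refine MartingaleProblem.martingale_natural_of_integral_sub_mul_prod_eq_zero hX hadapted
    (fun t => .of_bound ((hadapted t).mono (Filtration.le _ t)).aestronglyMeasurable _
      (ae_of_all _ fun ω => MartingaleProblem.abs_pathIncrement_le p.1 p.2 0 t (X ω)))
    fun s t hst k τ h hτ => ?_
  have hzero : ∫ ω, MartingaleProblem.testFunctional p.1 p.2 s t τ h 0 (X ω) ∂P = 0 := by
    refine MartingaleProblem.integral_testFunctional_zero_eq_zero_of_tendsto hconv hXm hX'm
      p.1 p.2 hst τ h ?_
    -- the horizon `t + 1` accommodates all translations by `v ≤ 1`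
    obtain ⟨ξ, φ, hmem, -, hξ, hφ⟩ := happrox p hp (t + 1) (by positivity)
    filter_upwards [MartingaleProblem.ae_add_toNNReal_notMem hΓ s,
      MartingaleProblem.ae_add_toNNReal_notMem hΓ t,
      ae_all_iff.2 fun i => MartingaleProblem.ae_add_toNNReal_notMem hΓ (τ i)]
      with v hvs hvt hvτ hv0 hv1
    have hv1' : v.toNNReal ≤ 1 := Real.toNNReal_le_one.2 hv1
    generalize v.toNNReal = w at *
    have hs : s + w ∈ Γ := Set.notMem_compl_iff.1 (hvs hv0)
    have ht : t + w ∈ Γ := Set.notMem_compl_iff.1 (hvt hv0)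
    have hτΓ : ∀ i, τ i + w ∈ Γ := fun i => Set.notMem_compl_iff.1 (hvτ i hv0)
    have hst' : s + w ≤ t + w := add_le_add_left hst w
    have htT : t + w ≤ t + 1 := add_le_add_right hv1' t
    have hτs : ∀ i, τ i + w ≤ s + w := fun i => add_le_add_left (hτ i) w
    have heq : ∀ n, ∫ ω, MartingaleProblem.testFunctional p.1 p.2 s t τ h w (X' n ω) ∂(P' n) = _ :=
      fun n => (h𝔛' n _ (hmem n)).integral_pathIncrement_mul (X' n) (hX'm n) p.1 p.2 hst'
        (H := fun ω => ∏ i, h i (X' n ω (τ i + w)))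
        (Finset.stronglyMeasurable_fun_prod _ fun i _ =>
          (h i).continuous.comp_stronglyMeasurable ((hX' n _).mono ((F' n).mono (hτs i))))
        (fun ω => MartingaleProblem.abs_prod_le h _)
    simp only [heq]
    have h1 := hξ (t + w) ⟨ht, htT⟩ k (fun i => τ i + w) h
      fun i => ⟨hτΓ i, (hτs i).trans hst'⟩
    have h2 := hξ (s + w) ⟨hs, hst'.trans htT⟩ k (fun i => τ i + w) h
      fun i => ⟨hτΓ i, hτs i⟩
    have h3 := hφ (t + w) ⟨ht, htT⟩ (s + w) ⟨hs, hst'⟩ k (fun i => τ i + w) h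
      fun i => ⟨hτΓ i, hτs i⟩
    simpa using (h1.neg.add h2).add h3
  refine (integral_congr_ae (ae_of_all _ fun ω => ?_)).trans hzero
  have hsplit := intervalIntegral.integral_interval_sub_left
    ((X ω).intervalIntegrable p.2 0 t) ((X ω).intervalIntegrable p.2 0 s)
  simp only [MartingaleProblem.testFunctional, MartingaleProblem.pathIncrement, add_zero, ← hsplit]
  ring
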